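/- Every finite simple graph $G=(V,E)$ whose average degree $\frac{1}{|V|}\sum_{v\in V}\deg(v)$ is at least $4182$, and which has no isolated edge (an edge sharing no endpoint with any other edge) and at most one isolated vertex, is antimagic; that is, there is a bijection $f:E\to\{1,\dots,|E|\}$ such that the vertex sums $\sum_{e\ni v} f(e)$, $v\in V$, are pairwise distinct. Hence there is an absolute constant $d_0$ (one may take $d_0=4182$) such that every finite simple graph with average degree at least $d_0$, no isolated edge and at most one isolated vertex is antimagic. In particular, every connected finite simple graph of average degree at least $4182$ is antimagic, so the Hartsfield–Ringel conjecture (every connected graph other than $K_2$ is antimagic) holds for connected graphs of average degree at least $4182$. -/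

import Mathlib

namespace SimpleGraph

/-- The average degree of a finite graph, `(∑ v, deg v) / |V|`. -/
noncomputable def avgDegree {V : Type*} [Fintype V] (G : SimpleGraph V) [DecidableRel G.Adj] : ℝ :=
  (∑ v : V, (G.degree v : ℝ)) / (Fintype.card V : ℝ)

/-- `uv` is an isolated edge: it is an edge, and it meets no other edge of the graph. -/
def IsIsolatedEdge {V : Type*} (G : SimpleGraph V) (u v : V) : Prop :=
  G.Adj u v ∧ (∀ w, G.Adj u w → w = v) ∧ (∀ w, G.Adj v w → w = u)

/-- The induced colour of a vertex `v` under a colouring `f` of the edges: the sum of the colours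
of the edges incident with `v`. Only the values of `f` at edges of `G` matter. -/
def inducedColour {V : Type*} [Fintype V] [DecidableEq V] (G : SimpleGraph V)
    [DecidableRel G.Adj] (f : Sym2 V → ℕ) (v : V) : ℕ :=
  ∑ e ∈ G.incidenceFinset v, f e

/-- A graph is antimagic if its edges can be labelled bijectively by `1, …, |E|` in such a way that
distinct vertices have distinct induced colours. -/
def IsAntimagic {V : Type*} [Fintype V] [DecidableEq V] (G : SimpleGraph V)
    [DecidableRel G.Adj] : Prop :=
  ∃ f : Sym2 V → ℕ, Set.BijOn f G.edgeSet (Set.Icc 1 G.edgeFinset.card) ∧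
    Function.Injective (G.inducedColour f)

end SimpleGraph

namespace SimpleGraph

open Finset

/-! ### Label swaps and the repair of one collision. -/

section Repair

variable {V : Type*} [Fintype V] [DecidableEq V] {G : SimpleGraph V} [DecidableRel G.Adj]

/-! Start from any bijective labelling and lower the number of colliding pairs by swapping labels
(`exists_repair`). If `u` and `v` collide, the hypotheses give an edge `e` containing exactly one of
them. Swapping the labels of `e` and a suitable `d` separates them, but an endpoint `a` of `d` may
hit any other vertex: quadratically many pairs threaten it, too many to avoid. So both endpoints of
`d` are freed by a further swap each, on an edge `s(a, w a)` whose label is easy to move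
(`exists_swap_of_card_blocked`). Double counting shows that all but linearly many edges are easy
(`card_stuckEdges_le`), and one swap changes this linearly little (`card_blocked_swap_le`). With `n`
vertices, every choice excludes `O(n)` edges, plus at most a quarter of them in the last two swaps.
-/

/-- Colours after exchanging the labels of two edges. -/
theorem inducedColour_swap (f : Sym2 V → ℕ) {e d : Sym2 V} (he : e ∈ G.edgeSet)
    (hd : d ∈ G.edgeSet) (t : V) :
    (G.inducedColour (f ∘ Equiv.swap e d) t : ℤ) = G.inducedColour f t
      + (if t ∈ e then (f d : ℤ) - f e else 0) + (if t ∈ d then (f e : ℤ) - f d else 0) := by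
  by_cases hed : e = d
  · subst hed
    simp
  have key : ∀ x : Sym2 V, (((f ∘ Equiv.swap e d) x : ℕ) : ℤ) =
      f x + (if x = e then (f d : ℤ) - f e else 0) + (if x = d then (f e : ℤ) - f d else 0) := by
    intro x
    by_cases h1 : x = e
    · subst h1
      simp [hed]
    · by_cases h2 : x = d
      · subst h2
        simp [h1]
      · simp [h1, h2, Equiv.swap_apply_of_ne_of_ne h1 h2]
  unfold inducedColour
  push_cast
  rw [Finset.sum_congr rfl fun x _ => key x, Finset.sum_add_distrib, Finset.sum_add_distrib,
    Finset.sum_ite_eq', Finset.sum_ite_eq']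
  simp [incidenceSet, he, hd]

theorem bijOn_comp_swap {α β : Type*} [DecidableEq α] {f : α → β} {t : Set α} {s : Set β}
    (hf : Set.BijOn f t s) {e d : α} (he : e ∈ t) (hd : d ∈ t) :
    Set.BijOn (f ∘ Equiv.swap e d) t s :=
  hf.comp (Equiv.bijOn_swap he hd)

/-- If each parameter in `I` excludes at most one element of `E`, at most `#I` are excluded. -/
theorem card_filter_exists_le {α ι : Type*} [DecidableEq α] (E : Finset α) (I : Finset ι)
    (P : ι → α → Prop) [DecidablePred fun a => ∃ i ∈ I, P i a]
    (h : ∀ i ∈ I, ∀ a ∈ E, ∀ b ∈ E, P i a → P i b → a = b) :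
    #{a ∈ E | ∃ i ∈ I, P i a} ≤ #I := by
  classical
  have hsub : {a ∈ E | ∃ i ∈ I, P i a} ⊆ I.biUnion fun i => {a ∈ E | P i a} := by
    intro a ha
    simp only [mem_filter, mem_biUnion] at ha ⊢
    obtain ⟨haE, i, hi, hP⟩ := ha
    exact ⟨i, hi, haE, hP⟩
  refine (card_le_card hsub).trans (card_biUnion_le.trans ?_)
  rw [card_eq_sum_ones]
  refine sum_le_sum fun i hi => card_le_one.2 fun a ha b hb => ?_
  simp only [mem_filter] at ha hb
  exact h i hi a ha.1 b hb.1 ha.2 hb.2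

theorem card_sym2_filter_mem_le (e : Sym2 V) : #{t : V | t ∈ e} ≤ 2 := by
  induction e with
  | _ a b =>
    have : ({t : V | t ∈ s(a, b)} : Finset V) = {a, b} := by
      ext t
      simp
    rw [this]
    exact card_le_two

theorem card_endpoints_product_le (e : Sym2 V) :
    #(({t : V | t ∈ e} : Finset V) ×ˢ (univ : Finset V)) ≤ 2 * Fintype.card V := by
  rw [card_product, card_univ]
  exact Nat.mul_le_mul_right _ (card_sym2_filter_mem_le e)

variable (G) in
/-- The ways in which moving the label `l` onto an edge `e` makes an endpoint `x` of `e` take the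
old colour of a vertex `z`, recorded as triples `(e, x, z)`. -/
def blocked (f : Sym2 V → ℕ) (l : ℕ) : Finset (Sym2 V × V × V) :=
  {p ∈ G.edgeFinset ×ˢ (univ : Finset V) ×ˢ (univ : Finset V) | p.2.1 ∈ p.1 ∧
    G.inducedColour f p.2.2 + f p.1 = G.inducedColour f p.2.1 + l}

theorem mem_blocked {f : Sym2 V → ℕ} {l : ℕ} {e : Sym2 V} {x z : V} :
    (e, x, z) ∈ G.blocked f l ↔ e ∈ G.edgeSet ∧ x ∈ e ∧
      G.inducedColour f z + f e = G.inducedColour f x + l := by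
  simp [blocked]

variable (G) in
/-- The edges whose label is hard to move elsewhere. -/
def stuckEdges (f : Sym2 V → ℕ) : Finset (Sym2 V) :=
  {e ∈ G.edgeFinset | #G.edgeFinset < 4 * #(G.blocked f (f e))}

/-- A triple determines `l`, so the blocked sets of distinct labels are disjoint, and there are at
most `2 * n` triples per edge in all. -/
theorem card_stuckEdges_le {f : Sym2 V → ℕ} (hf : Set.InjOn f G.edgeSet) :
    #(G.stuckEdges f) ≤ 8 * Fintype.card V := by
  rcases Nat.eq_zero_or_pos #G.edgeFinset with h0 | hpos
  · rw [card_eq_zero] at h0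
    simp [stuckEdges, h0]
  have hdisj : (G.stuckEdges f : Set (Sym2 V)).PairwiseDisjoint fun e => G.blocked f (f e) := by
    intro a ha b hb hab
    refine Finset.disjoint_left.2 ?_
    rintro ⟨e, x, z⟩ h1 h2
    simp only [stuckEdges, coe_filter, mem_edgeFinset, Set.mem_ofPred_eq] at ha hb
    rw [mem_blocked] at h1 h2
    exact hab (hf ha.1 hb.1 (by omega))
  have hsub : ((G.stuckEdges f).biUnion fun e => G.blocked f (f e)) ⊆
      G.edgeFinset.biUnion fun e =>
        (({t : V | t ∈ e} : Finset V) ×ˢ (univ : Finset V)).image fun p => (e, p) := by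
    rintro ⟨e, x, z⟩ h
    simp only [mem_biUnion] at h
    obtain ⟨a, -, ha⟩ := h
    rw [mem_blocked] at ha
    simp [ha.1, ha.2.1]
  have h1 : #((G.stuckEdges f).biUnion fun e => G.blocked f (f e)) ≤
      #G.edgeFinset * (2 * Fintype.card V) :=
    (card_le_card hsub).trans <| card_biUnion_le_card_mul _ _ _ fun e _ =>
      card_image_le.trans (card_endpoints_product_le e)
  rw [card_biUnion hdisj] at h1
  have h2 : #(G.stuckEdges f) * #G.edgeFinset ≤ ∑ e ∈ G.stuckEdges f, 4 * #(G.blocked f (f e)) := by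
    rw [← smul_eq_mul]
    exact card_nsmul_le_sum _ _ _ fun e he => (mem_filter.1 he).2.le
  rw [← mul_sum] at h2
  refine Nat.le_of_mul_le_mul_right ?_ hpos
  calc _ ≤ _ := h2
    _ ≤ 4 * (#G.edgeFinset * (2 * Fintype.card V)) := Nat.mul_le_mul_left _ h1
    _ = _ := by ring

/-- A new triple must have `x` or `z` among the at most four endpoints of `e` and `d`; given `l`,
the pair `(x, z)` determines the label, hence the edge. -/
theorem card_blocked_swap_le {f : Sym2 V → ℕ} (hf : Set.InjOn f G.edgeSet) {e d : Sym2 V}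
    (he : e ∈ G.edgeSet) (hd : d ∈ G.edgeSet) (l : ℕ) :
    #(G.blocked (f ∘ Equiv.swap e d) l) ≤ #(G.blocked f l) + 8 * Fintype.card V := by
  have hf' : Set.InjOn (f ∘ Equiv.swap e d) G.edgeSet :=
    (bijOn_comp_swap hf.bijOn_image he hd).injOn
  set f' := f ∘ Equiv.swap e d with hfdef
  set T : Finset V := ({t : V | t ∈ e} : Finset V) ∪ ({t : V | t ∈ d} : Finset V) with hT
  have hTcard : #T ≤ 4 :=
    (card_union_le _ _).trans
      (Nat.add_le_add (card_sym2_filter_mem_le e) (card_sym2_filter_mem_le d))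
  have hcol : ∀ t, t ∉ T → G.inducedColour f' t = G.inducedColour f t := by
    intro t ht
    simp only [hT, mem_union, mem_filter, mem_univ, true_and, not_or] at ht
    have := inducedColour_swap f he hd t
    simp only [ht.1, ht.2, if_false, add_zero] at this
    exact_mod_cast this
  set I : Finset (V × V) := T ×ˢ univ ∪ univ ×ˢ T with hI
  have hIcard : #I ≤ 8 * Fintype.card V := by
    refine (card_union_le _ _).trans ?_
    rw [card_product, card_product, card_univ]
    nlinarith
  have hnew : #(G.blocked f' l \ G.blocked f l) ≤ #I := by
    refine card_le_card_of_injOn (fun p => p.2) ?_ ?_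
    · rintro ⟨a, x, z⟩ hp
      rw [mem_coe, mem_sdiff, mem_blocked, mem_blocked] at hp
      obtain ⟨⟨haE, hxa, heq⟩, hn⟩ := hp
      by_contra hxz
      simp only [hI, mem_coe, mem_union, mem_product, mem_univ, and_true, true_and, not_or] at hxz
      refine hn ⟨haE, hxa, ?_⟩
      rw [hcol x hxz.1, hcol z hxz.2] at heq
      have hxT := hxz.1
      simp only [hT, mem_union, mem_filter, mem_univ, true_and, not_or] at hxT
      have hae : a ≠ e := fun h => hxT.1 (h ▸ hxa)
      have had : a ≠ d := fun h => hxT.2 (h ▸ hxa)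
      rwa [hfdef, Function.comp_apply, Equiv.swap_apply_of_ne_of_ne hae had] at heq
    · rintro ⟨a, p⟩ ha ⟨b, q⟩ hb (rfl : p = q)
      obtain ⟨x, z⟩ := p
      rw [mem_coe, mem_sdiff, mem_blocked] at ha hb
      have : a = b := hf' ha.1.1 hb.1.1 (by omega)
      rw [this]
  have := card_le_card_sdiff_add_card (s := G.blocked f' l) (t := G.blocked f l)
  omega

/-- If the label of `g` is easy to move, then it can be exchanged with the label of some edge other
than `h`, without creating collisions, so that endpoints of `g` only collide with each other. -/
theorem exists_swap_of_card_blocked {f : Sym2 V → ℕ} (hf : Set.InjOn f G.edgeSet) {g h : Sym2 V}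
    (hg : g ∈ G.edgeSet)
    (hcard : #(G.blocked f (f g)) + 6 * Fintype.card V + 2 < #G.edgeFinset) :
    ∃ d ∈ G.edgeSet, d ≠ h ∧ ∀ t z, t ≠ z →
      G.inducedColour (f ∘ Equiv.swap g d) t = G.inducedColour (f ∘ Equiv.swap g d) z →
      G.inducedColour f t = G.inducedColour f z ∧ (t ∈ g → z ∈ g) := by
  set c : V → ℤ := fun v => (G.inducedColour f v : ℤ) with hc
  set I : Finset (V × V) := ({t : V | t ∈ g} : Finset V) ×ˢ (univ : Finset V) with hI
  have hIcard : #I ≤ 2 * Fintype.card V := card_endpoints_product_le g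
  have hinj : ∀ a ∈ G.edgeFinset, ∀ b ∈ G.edgeFinset, f a = f b → a = b := fun a ha b hb hab =>
    hf (mem_edgeFinset.1 ha) (mem_edgeFinset.1 hb) hab
  have h1 := (card_filter_exists_le G.edgeFinset I (fun i a => a = s(i.1, i.2))
    fun i _ a _ b _ ha hb => ha.trans hb.symm).trans hIcard
  have h2 := (card_filter_exists_le G.edgeFinset I (fun i a => c i.1 + (f a - f g) = c i.2)
    fun i _ a ha b hb hPa hPb => hinj a ha b hb (by omega)).trans hIcard
  have h3 := (card_filter_exists_le G.edgeFinset I (fun i a => c i.1 + 2 * (f a - f g) = c i.2)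
    fun i _ a ha b hb hPa hPb => hinj a ha b hb (by omega)).trans hIcard
  have h4 : #((G.blocked f (f g)).image Prod.fst) ≤ #(G.blocked f (f g)) := card_image_le
  have h5 : #({g, h} : Finset (Sym2 V)) ≤ 2 := card_le_two
  set B1 := {a ∈ G.edgeFinset | ∃ i ∈ I, a = s(i.1, i.2)}
  set B2 := {a ∈ G.edgeFinset | ∃ i ∈ I, c i.1 + (f a - f g) = c i.2}
  set B3 := {a ∈ G.edgeFinset | ∃ i ∈ I, c i.1 + 2 * (f a - f g) = c i.2}
  set B4 := (G.blocked f (f g)).image Prod.fst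
  -- Excluded in turn: `d` meeting `g`; an endpoint of `g` hitting an unmoved vertex; one hitting an
  -- endpoint of `d`, which moves oppositely; an endpoint of `d` hitting an unmoved vertex.
  have hB : #(B1 ∪ (B2 ∪ (B3 ∪ (B4 ∪ {g, h})))) < #G.edgeFinset := by
    have e1 := card_union_le B1 (B2 ∪ (B3 ∪ (B4 ∪ {g, h})))
    have e2 := card_union_le B2 (B3 ∪ (B4 ∪ {g, h}))
    have e3 := card_union_le B3 (B4 ∪ {g, h})
    have e4 := card_union_le B4 {g, h}
    omega
  obtain ⟨d, hdE, hd⟩ := exists_mem_notMem_of_card_lt_card hB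
  simp only [mem_union, not_or, mem_insert, mem_singleton] at hd
  obtain ⟨n1, n2, n3, n4, -, hdh⟩ := hd
  have hdE' := mem_edgeFinset.1 hdE
  have d1 : ∀ t ∈ g, t ∉ d := by
    intro t htg htd
    obtain ⟨y, rfl⟩ := htd
    exact n1 (mem_filter.2 ⟨hdE, (t, y), by simp [hI, htg], rfl⟩)
  have d2 : ∀ t ∈ g, ∀ z, c t + (f d - f g) ≠ c z := fun t ht z hz =>
    n2 (mem_filter.2 ⟨hdE, (t, z), by simp [hI, ht], hz⟩)
  have d3 : ∀ t ∈ g, ∀ z, c t + 2 * (f d - f g) ≠ c z := fun t ht z hz =>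
    n3 (mem_filter.2 ⟨hdE, (t, z), by simp [hI, ht], hz⟩)
  have d4 : ∀ t ∈ d, ∀ z, c t + (f g - f d) ≠ c z := fun t ht z hz =>
    n4 (mem_image.2 ⟨(d, t, z), mem_blocked.2 ⟨hdE', ht, by simp only [hc] at hz; omega⟩, rfl⟩)
  refine ⟨d, hdE', hdh, fun t z _ heq => ?_⟩
  have ht := inducedColour_swap f hg hdE' t
  have hz := inducedColour_swap f hg hdE' z
  rw [heq] at ht
  have hcz : c z = G.inducedColour f z := rfl
  have hct : c t = G.inducedColour f t := rfl
  have t1 := d1 t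
  have z1 := d1 z
  have t2 := fun h => d2 t h z
  have z2 := fun h => d2 z h t
  have t3 := fun h => d3 t h z
  have z3 := fun h => d3 z h t
  have t4 := fun h => d4 t h z
  have z4 := fun h => d4 z h t
  by_cases tg : t ∈ g <;> by_cases td : t ∈ d <;> by_cases zg : z ∈ g <;> by_cases zd : z ∈ d <;>
    simp only [tg, td, zg, zd, if_true, if_false, not_true, not_false_eq_true, true_implies,
      false_implies, ne_eq, and_true] at * <;> omega

/-- A collision at a vertex `u` incident with an edge that misses `v` can be removed without
creating other collisions. -/
theorem exists_repair {f : Sym2 V → ℕ} (hf : Set.BijOn f G.edgeSet (Set.Icc 1 #G.edgeFinset))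
    (hcard : 100 * Fintype.card V ≤ #G.edgeFinset) {u v : V} {e : Sym2 V} (he : e ∈ G.edgeSet)
    (hue : u ∈ e) (hve : v ∉ e) :
    ∃ f' : Sym2 V → ℕ, Set.BijOn f' G.edgeSet (Set.Icc 1 #G.edgeFinset) ∧
      G.inducedColour f' u ≠ G.inducedColour f' v ∧
      ∀ t z, t ≠ z → G.inducedColour f' t = G.inducedColour f' z →
        G.inducedColour f t = G.inducedColour f z := by
  have hV : 0 < Fintype.card V := Fintype.card_pos_iff.2 ⟨u⟩
  set c : V → ℤ := fun v => (G.inducedColour f v : ℤ) with hc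
  -- Fixing `w` before `d` makes each condition on `a` and `w a` exclude at most one `d` per vertex.
  -- Since `d` will not be stuck, its endpoints have a usable `w`.
  have hG : ∃ w : V → V, ∀ a b, s(a, b) ∈ G.edgeSet → s(a, b) ∉ G.stuckEdges f →
      s(a, w a) ∈ G.edgeSet ∧ s(a, w a) ∉ G.stuckEdges f := by
    have : ∀ a, ∃ y, ∀ b, s(a, b) ∈ G.edgeSet → s(a, b) ∉ G.stuckEdges f →
        s(a, y) ∈ G.edgeSet ∧ s(a, y) ∉ G.stuckEdges f := by
      intro a
      by_cases h : ∃ y, s(a, y) ∈ G.edgeSet ∧ s(a, y) ∉ G.stuckEdges f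
      · obtain ⟨y, hy⟩ := h
        exact ⟨y, fun _ _ _ => hy⟩
      · exact ⟨a, fun b h1 h2 => (h ⟨b, h1, h2⟩).elim⟩
    choose w hw using this
    exact ⟨w, hw⟩
  obtain ⟨w, hw⟩ := hG
  set I : Finset (V × V) := ({t : V | t ∈ e} : Finset V) ×ˢ (univ : Finset V) with hI
  have hIcard : #I ≤ 2 * Fintype.card V := card_endpoints_product_le e
  have hinj : ∀ a ∈ G.edgeFinset, ∀ b ∈ G.edgeFinset, f a = f b → a = b := fun a ha b hb hab =>
    hf.injOn (mem_edgeFinset.1 ha) (mem_edgeFinset.1 hb) hab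
  have hS := card_stuckEdges_le hf.injOn
  have h1 := (card_filter_exists_le G.edgeFinset I (fun i a => a = s(i.1, i.2))
    fun i _ a _ b _ ha hb => ha.trans hb.symm).trans hIcard
  have h2 := (card_filter_exists_le G.edgeFinset I (fun i a => c i.1 + (f a - f e) = c i.2)
    fun i _ a ha b hb hPa hPb => hinj a ha b hb (by omega)).trans hIcard
  have h3 := card_filter_exists_le G.edgeFinset univ (fun i a => a = s(i, w i))
    fun i _ a _ b _ ha hb => ha.trans hb.symm
  have h4 := card_filter_exists_le G.edgeFinset univ (fun i a => c i + (f e - f a) = c (w i))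
    fun i _ a ha b hb hPa hPb => hinj a ha b hb (by omega)
  have h5 := card_filter_exists_le G.edgeFinset univ (fun i a => c i + 2 * (f e - f a) = c (w i))
    fun i _ a ha b hb hPa hPb => hinj a ha b hb (by omega)
  rw [card_univ] at h3 h4 h5
  set B1 := {a ∈ G.edgeFinset | ∃ i ∈ I, a = s(i.1, i.2)}
  set B2 := {a ∈ G.edgeFinset | ∃ i ∈ I, c i.1 + (f a - f e) = c i.2}
  set B3 := {a ∈ G.edgeFinset | ∃ i ∈ (univ : Finset V), a = s(i, w i)}
  set B4 := {a ∈ G.edgeFinset | ∃ i ∈ (univ : Finset V), c i + (f e - f a) = c (w i)}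
  set B5 := {a ∈ G.edgeFinset | ∃ i ∈ (univ : Finset V), c i + 2 * (f e - f a) = c (w i)}
  -- At most `(2 + 2 + 1 + 1 + 1 + 8) * n` edges are excluded.
  have hB : #(B1 ∪ (B2 ∪ (B3 ∪ (B4 ∪ (B5 ∪ G.stuckEdges f))))) < #G.edgeFinset := by
    have e1 := card_union_le B1 (B2 ∪ (B3 ∪ (B4 ∪ (B5 ∪ G.stuckEdges f))))
    have e2 := card_union_le B2 (B3 ∪ (B4 ∪ (B5 ∪ G.stuckEdges f)))
    have e3 := card_union_le B3 (B4 ∪ (B5 ∪ G.stuckEdges f))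
    have e4 := card_union_le B4 (B5 ∪ G.stuckEdges f)
    have e5 := card_union_le B5 (G.stuckEdges f)
    omega
  obtain ⟨d, hdE, hd⟩ := exists_mem_notMem_of_card_lt_card hB
  simp only [mem_union, not_or] at hd
  obtain ⟨n1, n2, n3, n4, n5, n6⟩ := hd
  have hdE' := mem_edgeFinset.1 hdE
  have d1 : ∀ t ∈ e, t ∉ d := by
    intro t hte htd
    obtain ⟨y, rfl⟩ := htd
    exact n1 (mem_filter.2 ⟨hdE, (t, y), by simp [hI, hte], rfl⟩)
  have d2 : ∀ t ∈ e, ∀ z, c t + (f d - f e) ≠ c z := fun t ht z hz =>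
    n2 (mem_filter.2 ⟨hdE, (t, z), by simp [hI, ht], hz⟩)
  have d3 : ∀ a, d ≠ s(a, w a) := fun a ha => n3 (mem_filter.2 ⟨hdE, a, mem_univ _, ha⟩)
  have d4 : ∀ a, c a + (f e - f d) ≠ c (w a) := fun a ha =>
    n4 (mem_filter.2 ⟨hdE, a, mem_univ _, ha⟩)
  have d5 : ∀ a, c a + 2 * (f e - f d) ≠ c (w a) := fun a ha =>
    n5 (mem_filter.2 ⟨hdE, a, mem_univ _, ha⟩)
  set f₁ := f ∘ Equiv.swap e d with hf₁
  have hb₁ := bijOn_comp_swap hf he hdE'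
  have hcol₁ := inducedColour_swap f he hdE'
  have hdw : ∀ a ∈ d, s(a, w a) ∈ G.edgeSet ∧ s(a, w a) ∉ G.stuckEdges f ∧ a ≠ w a ∧ w a ∉ d ∧
      f₁ s(a, w a) = f s(a, w a) ∧ G.inducedColour f₁ a ≠ G.inducedColour f₁ (w a) := by
    intro a ha
    obtain ⟨y, hy⟩ := ha
    have had : a ∈ d := hy ▸ Sym2.mem_mk_left a y
    obtain ⟨q1, q2⟩ := hw a y (hy ▸ hdE') (hy ▸ n6)
    have hne : a ≠ w a := G.ne_of_adj q1
    have hwd : w a ∉ d := by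
      intro h
      refine d3 a ?_
      exact ((Sym2.mem_and_mem_iff hne).1 ⟨had, h⟩)
    have hae : a ∉ e := fun h => d1 a h had
    refine ⟨q1, q2, hne, hwd, ?_, ?_⟩
    · rw [hf₁, Function.comp_apply, Equiv.swap_apply_of_ne_of_ne _ (d3 a).symm]
      intro h
      exact hae (h ▸ Sym2.mem_mk_left a (w a))
    · intro h
      have r1 := hcol₁ a
      have r2 := hcol₁ (w a)
      rw [← hf₁] at r1 r2
      rw [h] at r1
      have r4 := d4 a
      have r5 := d5 a
      have hca : c a = G.inducedColour f a := rfl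
      have hcw : c (w a) = G.inducedColour f (w a) := rfl
      by_cases hwe : w a ∈ e <;>
        simp only [had, hae, hwd, hwe, if_true, if_false] at r1 r2 <;> omega
  obtain ⟨⟨a, b⟩, hab⟩ := Quot.exists_rep d
  change s(a, b) = d at hab
  have had : a ∈ d := hab ▸ Sym2.mem_mk_left a b
  have hbd : b ∈ d := hab ▸ Sym2.mem_mk_right a b
  obtain ⟨ga, sa, -, wad, fa, ca⟩ := hdw a had
  obtain ⟨gb, sb, -, -, fb, cb⟩ := hdw b hbd
  have hmild : ∀ g ∈ G.edgeSet, g ∉ G.stuckEdges f →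
      4 * #(G.blocked f (f g)) ≤ #G.edgeFinset := by
    intro g hg hs
    by_contra h
    exact hs (mem_filter.2 ⟨mem_edgeFinset.2 hg, not_le.1 h⟩)
  have ka := hmild _ ga sa
  have kb := hmild _ gb sb
  have ka₁ := card_blocked_swap_le hf.injOn he hdE' (f s(a, w a))
  have kb₁ := card_blocked_swap_le hf.injOn he hdE' (f s(b, w b))
  rw [← hf₁] at ka₁ kb₁ hb₁
  -- Avoiding `s(b, w b)` keeps its label unchanged for the third swap.
  obtain ⟨p, hpE, hpb, hp⟩ := exists_swap_of_card_blocked (h := s(b, w b)) hb₁.injOn ga (by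
    rw [fa]
    omega)
  have hb₂ := bijOn_comp_swap hb₁ ga hpE
  have kb₂ := card_blocked_swap_le hb₁.injOn ga hpE (f s(b, w b))
  have hne : s(b, w b) ≠ s(a, w a) := by
    intro h
    have hb' : b ∈ s(a, w a) := h ▸ Sym2.mem_mk_left b (w b)
    rcases Sym2.mem_iff.1 hb' with h' | h'
    · subst h'
      exact G.ne_of_adj (show G.Adj b b by rw [← mem_edgeSet, hab]; exact hdE') rfl
    · exact wad (h' ▸ hbd)
  have fb₂ : (f₁ ∘ Equiv.swap s(a, w a) p) s(b, w b) = f s(b, w b) := by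
    rw [Function.comp_apply, Equiv.swap_apply_of_ne_of_ne hne hpb.symm, fb]
  set f₂ := f₁ ∘ Equiv.swap s(a, w a) p
  obtain ⟨q, hqE, -, hq⟩ := exists_swap_of_card_blocked (h := p) hb₂.injOn gb (by
    rw [fb₂]
    omega)
  have hb₃ := bijOn_comp_swap hb₂ gb hqE
  set f₃ := f₂ ∘ Equiv.swap s(b, w b) q
  -- After its swap, `a` could collide only with `w a`, but these two already differed under `f₁`
  -- and no swap since creates a collision; likewise for `b`.
  have hnd : ∀ t z, t ≠ z → G.inducedColour f₃ t = G.inducedColour f₃ z → t ∉ d := by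
    intro t z htz h3 htd
    obtain ⟨h2, hbz⟩ := hq t z htz h3
    obtain ⟨h1, haz⟩ := hp t z htz h2
    rw [← hab, Sym2.mem_iff] at htd
    rcases htd with rfl | rfl
    · rcases Sym2.mem_iff.1 (haz (Sym2.mem_mk_left _ _)) with h | h
      · exact htz h.symm
      · exact ca (h ▸ h1)
    · rcases Sym2.mem_iff.1 (hbz (Sym2.mem_mk_left _ _)) with h | h
      · exact htz h.symm
      · exact cb (h ▸ h1)
  have key : ∀ t z, t ≠ z → G.inducedColour f₃ t = G.inducedColour f₃ z →
      G.inducedColour f t = G.inducedColour f z ∧ (t ∈ e → z ∈ e) := by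
    intro t z htz h3
    have td := hnd t z htz h3
    have zd := hnd z t htz.symm h3.symm
    have h1 := (hp t z htz (hq t z htz h3).1).1
    have r1 := hcol₁ t
    have r2 := hcol₁ z
    rw [← hf₁] at r1 r2
    rw [h1] at r1
    have hct : c t = G.inducedColour f t := rfl
    have hcz : c z = G.inducedColour f z := rfl
    have t2 := fun h => d2 t h z
    have z2 := fun h => d2 z h t
    by_cases te : t ∈ e <;> by_cases ze : z ∈ e <;>
      simp only [te, ze, td, zd, if_true, if_false, true_implies, false_implies, and_true, ne_eq]
        at * <;> omega
  exact ⟨f₃, hb₃, fun h => hve ((key u v (fun h => hve (h ▸ hue)) h).2 hue),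
    fun t z htz h => (key t z htz h).1⟩

end Repair

/-! ### Induction on the number of collisions. -/

/-- A graph with no isolated edge, at most one isolated vertex and at least `100 |V|` edges is
antimagic. -/
theorem isAntimagic_of_card_edgeFinset {V : Type*} [Fintype V] [DecidableEq V]
    (G : SimpleGraph V) [DecidableRel G.Adj] (hcard : 100 * Fintype.card V ≤ #G.edgeFinset)
    (hE : ∀ u v : V, ¬ G.IsIsolatedEdge u v)
    (hI : ∀ u v : V, G.IsIsolated u → G.IsIsolated v → u = v) : G.IsAntimagic := by
  have hsep : ∀ u v : V, u ≠ v →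
      (∃ e ∈ G.edgeSet, u ∈ e ∧ v ∉ e) ∨ ∃ e ∈ G.edgeSet, v ∈ e ∧ u ∉ e := by
    intro u v huv
    by_contra! h
    have hu : ∀ x, G.Adj u x → x = v := by
      intro x hx
      rcases Sym2.mem_iff.1 (h.1 s(u, x) hx (Sym2.mem_mk_left _ _)) with h' | h'
      · exact (huv h'.symm).elim
      · exact h'.symm
    have hv : ∀ x, G.Adj v x → x = u := by
      intro x hx
      rcases Sym2.mem_iff.1 (h.2 s(v, x) hx (Sym2.mem_mk_left _ _)) with h' | h'
      · exact (huv h').elim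
      · exact h'.symm
    by_cases hadj : G.Adj u v
    · exact hE u v ⟨hadj, hu, hv⟩
    · exact huv (hI u v (fun x hx => hadj (hu x hx ▸ hx)) fun x hx => hadj (hv x hx ▸ hx).symm)
  let collisions : (Sym2 V → ℕ) → Finset (V × V) := fun f =>
    {p : V × V | p.1 ≠ p.2 ∧ G.inducedColour f p.1 = G.inducedColour f p.2}
  have main : ∀ k : ℕ, ∀ f : Sym2 V → ℕ, Set.BijOn f G.edgeSet (Set.Icc 1 #G.edgeFinset) →
      #(collisions f) = k → G.IsAntimagic := by
    intro k
    induction k using Nat.strong_induction_on with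
    | _ k ih =>
      intro f hf hk
      by_cases hinj : Function.Injective (G.inducedColour f)
      · exact ⟨f, hf, hinj⟩
      obtain ⟨u, v, huv, hne⟩ := Function.not_injective_iff.1 hinj
      have step : ∀ u v, G.inducedColour f u = G.inducedColour f v → u ≠ v →
          (∃ e ∈ G.edgeSet, u ∈ e ∧ v ∉ e) → G.IsAntimagic := by
        rintro u v huv hne ⟨e, he, hue, hve⟩
        obtain ⟨f', hf', h1, h2⟩ := exists_repair hf hcard he hue hve
        refine ih _ ?_ f' hf' rfl
        rw [← hk]
        refine card_lt_card ((ssubset_iff_of_subset ?_).2 ⟨(u, v), ?_, ?_⟩)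
        · intro p hp
          simp only [collisions, mem_filter, mem_univ, true_and] at hp ⊢
          exact ⟨hp.1, h2 _ _ hp.1 hp.2⟩
        · simp [collisions, hne, huv]
        · simp [collisions, h1]
      rcases hsep u v hne with h | h
      · exact step u v huv hne h
      · exact step v u huv.symm hne.symm h
  have hex : ∃ f : Sym2 V → ℕ, Set.BijOn f G.edgeSet (Set.Icc 1 #G.edgeFinset) := by
    refine (Set.toFinite G.edgeSet).exists_bijOn_of_encard_eq ?_
    rw [← coe_edgeFinset, ← coe_Icc, Set.encard_coe_eq_coe_finsetCard,
      Set.encard_coe_eq_coe_finsetCard, Nat.card_Icc, Nat.add_sub_cancel]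
  obtain ⟨f, hf⟩ := hex
  exact main _ f hf rfl

/-! ### Average degree and connected graphs. -/

theorem card_le_card_edgeFinset_of_avgDegree {V : Type*} [Fintype V] [DecidableEq V]
    (G : SimpleGraph V) [DecidableRel G.Adj] (h : 4182 ≤ G.avgDegree) :
    0 < Fintype.card V ∧ 2091 * Fintype.card V ≤ #G.edgeFinset := by
  unfold avgDegree at h
  have hpos : 0 < Fintype.card V := by
    rcases Nat.eq_zero_or_pos (Fintype.card V) with h0 | h0
    · rw [h0] at h
      norm_num at h
    · exact h0
  refine ⟨hpos, ?_⟩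
  rw [le_div_iff₀ (by exact_mod_cast hpos)] at h
  have h' : 4182 * Fintype.card V ≤ ∑ v, G.degree v := by exact_mod_cast h
  rw [sum_degrees_eq_twice_card_edges] at h'
  omega

theorem Connected.isAntimagic_of_avgDegree {V : Type*} [Fintype V] [DecidableEq V]
    {G : SimpleGraph V} [DecidableRel G.Adj] (hG : G.Connected) (h : 4182 ≤ G.avgDegree) :
    G.IsAntimagic := by
  obtain ⟨hpos, hm⟩ := card_le_card_edgeFinset_of_avgDegree G h
  have hchoose := G.card_edgeFinset_le_card_choose_two
  have hclosed : ∀ s : Finset V, s.Nonempty → (∀ x ∈ s, ∀ y, G.Adj x y → y ∈ s) →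
      Fintype.card V ≤ #s := by
    rintro s ⟨x, hx⟩ hs
    rw [← card_univ]
    refine card_le_card fun y _ => ?_
    have hwalk : ∀ a b, G.Walk a b → a ∈ s → b ∈ s := by
      intro a b p
      induction p with
      | nil => exact id
      | cons hadj _ ih => exact fun ha => ih (hs _ ha _ hadj)
    exact hwalk x y (hG.preconnected x y).some hx
  -- One or two vertices carry at most one edge, too few for the density; connectedness then rules
  -- out isolated edges and vertices.
  have hlarge : 2 < Fintype.card V := by
    by_contra hle
    have : Fintype.card V = 1 ∨ Fintype.card V = 2 := by omega
    have h12 : Nat.choose 1 2 = 0 := rfl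
    have h22 : Nat.choose 2 2 = 1 := rfl
    rcases this with h1 | h1 <;> rw [h1] at hm hchoose <;> omega
  refine isAntimagic_of_card_edgeFinset G (by omega) ?_ ?_
  · rintro u v ⟨-, hu, hv⟩
    have := hclosed {u, v} ⟨u, by simp⟩ (by
      intro x hx y hxy
      simp only [mem_insert, mem_singleton] at hx ⊢
      rcases hx with rfl | rfl
      · exact Or.inr (hu y hxy)
      · exact Or.inl (hv y hxy))
    have := card_le_two (a := u) (b := v)
    omega
  · intro u v hu _
    have := hclosed {u} ⟨u, by simp⟩ (by
      intro x hx y hxy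
      rw [mem_singleton] at hx
      subst hx
      exact (hu y hxy).elim)
    rw [card_singleton] at this
    omega

end SimpleGraph

/-- Every finite graph of average degree at least `4182` with no isolated edge and at most one
isolated vertex is antimagic; in particular, every connected finite graph of average degree at
least `4182` is antimagic. -/
theorem theorem1 :
    (∀ (V : Type*) [Fintype V] [DecidableEq V] (G : SimpleGraph V) [DecidableRel G.Adj],
      4182 ≤ G.avgDegree →
      (∀ u v : V, ¬ G.IsIsolatedEdge u v) →
      (∀ u v : V, G.IsIsolated u → G.IsIsolated v → u = v) →
      G.IsAntimagic) ∧
    (∀ (V : Type*) [Fintype V] [DecidableEq V] (G : SimpleGraph V) [DecidableRel G.Adj],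
      G.Connected → 4182 ≤ G.avgDegree → G.IsAntimagic) := by
  refine ⟨fun V _ _ G _ h hE hI => ?_, fun V _ _ G _ hG h => hG.isAntimagic_of_avgDegree h⟩
  have := (SimpleGraph.card_le_card_edgeFinset_of_avgDegree G h).2
  exact SimpleGraph.isAntimagic_of_card_edgeFinset G (by omega) hE hI
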